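/- Let $n\ge 1$ and let $G$ be a cycle-plus-triangles (multi)graph on $3n$ vertices: the edge set of $G$ is the disjoint union (parallel edges counted separately) of the edges of a Hamiltonian cycle $x_1 - x_2 - \dots - x_{3n} - x_1$ and of the edges of $n$ triangles $a_i - b_i - c_i - a_i$ $(1\le i\le n)$ whose vertex sets partition the vertex set. Identify the vertices with variables $x_1,\dots,x_{3n}$, put $x_{3n+1}=x_1$, and let $$\Phi(x_1,\dots,x_{3n})=\prod_{i=1}^{3n}\Bigl(1-\frac{x_{i+1}}{x_i}\Bigr)\prod_{i=1}^{n}\Bigl(1-\frac{a_i}{b_i}\Bigr)\Bigl(1-\frac{b_i}{c_i}\Bigr)\Bigl(1-\frac{c_i}{a_i}\Bigr),$$ a Laurent polynomial with integer coefficients; let $CT[\Phi]\in\mathbb Z$ be its constant term. For a $3$-element subset $A=\{u,v,w\}$ of a field put $\varphi_A(u)=\frac{vw}{(u-v)(u-w)}$, and similarly for $v$ and $w$. Then: 1. For every field $K$ (in particular $K=\mathbb R$) and all $3$-element sets $A_1,\dots,A_{3n}\subset K\setminus\{0\}$, the following holds in $K$: $$CT[\Phi]=\sum_{(x_1,\dots,x_{3n})\in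 A_1\times\dots\times A_{3n}}\Phi(x_1,\dots,x_{3n})\prod_{i=1}^{3n}\varphi_{A_i}(x_i).$$ 2. $CT[\Phi]\neq 0$. 3. For every field $K$ and all $3$-element sets $A_1,\dots,A_{3n}\subset K\setminus\{0\}$, $\Phi$ does not vanish identically on $A_1\times\dots\times A_{3n}$. 4. $G$ is $3$-choosable: whenever each vertex of $G$ is given a list of at least $3$ colours (from an arbitrary set of colours), one can colour each vertex with a colour from its list so that the two ends of every edge have different colours. -/

import Mathlib

open scoped Graph

universe uV uE uC uK

/-- A presentation of the multigraph `G` as a cycle-plus-triangles graph: `G` has `3n` vertices,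
and its edge set is the disjoint union (parallel edges being counted separately) of the edges of
a Hamiltonian cycle `x₀ - x₁ - ⋯ - x_{3n-1} - x₀` and of `n` triangles `aᵢ - bᵢ - cᵢ - aᵢ` whose
vertex sets partition the vertices of `G`. -/
structure CyclePlusTriangles {V : Type uV} {E : Type uE} (G : Graph V E) (n : ℕ) where
  /-- The vertices in the order of the Hamiltonian cycle. -/
  x : Fin (3 * n) ≃ ↥G.vertexSet
  /-- `tri (i, 0)`, `tri (i, 1)`, `tri (i, 2)` are the vertices `aᵢ`, `bᵢ`, `cᵢ`. -/
  tri : Fin n × Fin 3 ≃ ↥G.vertexSet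
  /-- All the edges of `G`, each listed exactly once. -/
  edge : Fin (3 * n) ⊕ (Fin n × Fin 3) ≃ ↥G.edgeSet
  /-- The first `3n` edges form the cycle (`finRotate` is the cyclic successor). -/
  isLink_cycle : ∀ i : Fin (3 * n),
    G.IsLink (edge (Sum.inl i)) (x i) (x (finRotate (3 * n) i))
  /-- The other `3n` edges form the triangles (the addition in `Fin 3` is modulo `3`). -/
  isLink_tri : ∀ (i : Fin n) (j : Fin 3),
    G.IsLink (edge (Sum.inr (i, j))) (tri (i, j)) (tri (i, j + 1))

/-- A multigraph is `k`-choosable if, whenever each vertex gets a list of at least `k` colours,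
one can colour each vertex from its list so that the ends of every edge get different colours. -/
def Graph.IsChoosable {V : Type uV} {E : Type uE} (G : Graph V E) (k : ℕ) : Prop :=
  ∀ (C : Type uC) (L : ↥G.vertexSet → Finset C), (∀ v, k ≤ (L v).card) →
    ∃ c : ↥G.vertexSet → C, (∀ v, c v ∈ L v) ∧
      ∀ (e : E) (u v : ↥G.vertexSet), G.IsLink e u v → c u ≠ c v

/-- Laurent polynomials with integer coefficients in the variables indexed by `σ`. -/
abbrev MvLaurent (σ : Type*) : Type _ := AddMonoidAlgebra ℤ (σ →₀ ℤ)

namespace MvLaurent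

variable {σ : Type*}

/-- The Laurent monomial `x_i / x_j`. -/
noncomputable def ratio (i j : σ) : MvLaurent σ :=
  AddMonoidAlgebra.single (Finsupp.single i 1 - Finsupp.single j 1) 1

/-- The constant term of a Laurent polynomial. -/
def CT (f : MvLaurent σ) : ℤ := f.coeff 0

/-- The value of a Laurent polynomial at a point with nonzero coordinates in a field. -/
noncomputable def eval {K : Type*} [Field K] (x : σ → K) (f : MvLaurent σ) : K :=
  f.coeff.sum fun d c => (c : K) * d.prod fun i m => x i ^ m

end MvLaurent

/-- The Laurent polynomial
`Φ = ∏ (1 - x_{i+1} / x_i) * ∏ (1 - aᵢ / bᵢ) (1 - bᵢ / cᵢ) (1 - cᵢ / aᵢ)`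
in the variables `x_i`, where a vertex is identified with its variable. -/
noncomputable def CyclePlusTriangles.Phi {V : Type uV} {E : Type uE} {G : Graph V E} {n : ℕ}
    (D : CyclePlusTriangles G n) : MvLaurent (Fin (3 * n)) :=
  (∏ i : Fin (3 * n), (1 - MvLaurent.ratio (finRotate (3 * n) i) i)) *
    ∏ i : Fin n, ∏ j : Fin 3,
      (1 - MvLaurent.ratio (D.x.symm (D.tri (i, j))) (D.x.symm (D.tri (i, j + 1))))

open Classical in
/-- The interpolation weight of `u ∈ A`: for `A = {u, v, w}` it is `v w / ((u - v) (u - w))`. -/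
noncomputable def interpWeight {K : Type uK} [Field K] (A : Finset K) (u : K) : K :=
  ∏ v ∈ A.erase u, v / (u - v)

/-! Interpolation writes the constant term as a weighted sum of values of `Phi` on a grid of
three-element sets, so over `ℚ` a nonzero constant term yields a point where no factor vanishes,
that is, a proper colouring from the lists.

The constant term is nonzero because it is 2 modulo 4. It is the signed count of the edge selections
that are balanced at every vertex. Complementing a selection preserves its sign, there being `6n`
edges, so the selections omitting one fixed cycle edge contribute exactly half
(`triangleWeight_add_one`). Modulo 2, a triangle contributes only if exactly one of its vertices
sees no change between its two cycle edges (`triangleWeight_cast`). A choice `X` of these vertices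
determines the cycle part, by partial sums. What remains is a sum over `X` of products of row sums
of a matrix that is symmetric modulo 2, and `ZMod.two_sum_prod_sum_eq_one` evaluates it to 1. -/

/-! ### Interpolation of the constant term -/

/-- The weights are the values at 0 of the Lagrange basis on `A`, and interpolation at three nodes
is exact up to degree 2. -/
theorem sum_zpow_mul_interpWeight {K : Type*} [Field K] {A : Finset K} (hA : A.card = 3)
    (h0 : (0 : K) ∉ A) {m : ℤ} (hm0 : 0 ≤ m) (hm2 : m ≤ 2) :
    ∑ u ∈ A, u ^ m * interpWeight A u = if m = 0 then 1 else 0 := by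
  classical
  obtain ⟨u, v, w, huv, huw, hvw, rfl⟩ := Finset.card_eq_three.1 hA
  have hu : u ≠ 0 := by rintro rfl; simp at h0
  have hv : v ≠ 0 := by rintro rfl; simp at h0
  have hw : w ≠ 0 := by rintro rfl; simp at h0
  have e1 : interpWeight {u, v, w} u = v / (u - v) * (w / (u - w)) := by
    rw [interpWeight, show ({u, v, w} : Finset K).erase u = {v, w} by grind,
      Finset.prod_pair hvw]
  have e2 : interpWeight {u, v, w} v = u / (v - u) * (w / (v - w)) := by
    rw [interpWeight, show ({u, v, w} : Finset K).erase v = {u, w} by grind,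
      Finset.prod_pair huw]
  have e3 : interpWeight {u, v, w} w = u / (w - u) * (v / (w - v)) := by
    rw [interpWeight, show ({u, v, w} : Finset K).erase w = {u, v} by grind,
      Finset.prod_pair huv]
  rw [Finset.sum_insert (by simp [huv, huw]), Finset.sum_pair hvw, e1, e2, e3]
  have h1 := sub_ne_zero.2 huv
  have h2 := sub_ne_zero.2 huw
  have h3 := sub_ne_zero.2 hvw
  rw [← neg_sub u v, ← neg_sub u w, ← neg_sub v w]
  interval_cases m
  · simp only [zpow_zero, if_true]; field_simp; ring
  · simp only [zpow_one, one_ne_zero, if_false]; field_simp; ring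
  · rw [if_neg (by norm_num)]; norm_cast; field_simp; ring

namespace MvLaurent

theorem CT_eq_sum_eval_mul_interpWeight {σ K : Type*} [Fintype σ] [DecidableEq σ] [Field K]
    (f : MvLaurent σ) (hf : ∀ d ∈ f.coeff.support, ∑ i, d i = 0 ∧ ∀ i, d i ≤ 2)
    (A : σ → Finset K) (hA : ∀ i, (A i).card = 3) (h0 : ∀ i, (0 : K) ∉ A i) :
    ((f.CT : ℤ) : K) =
      ∑ x ∈ Fintype.piFinset A, f.eval x * ∏ i, interpWeight (A i) (x i) := by
  have key : ∀ d ∈ f.coeff.support,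
      ∑ x ∈ Fintype.piFinset A, (f.coeff d : K) * (d.prod fun i m => x i ^ m) *
        ∏ i, interpWeight (A i) (x i) = if d = 0 then (f.coeff d : K) else 0 := by
    intro d hd
    obtain ⟨hsum, hle⟩ := hf d hd
    have h1 : ∀ x : σ → K, (f.coeff d : K) * (d.prod fun i m => x i ^ m) *
        ∏ i, interpWeight (A i) (x i) =
        f.coeff d * ∏ i, (x i ^ d i * interpWeight (A i) (x i)) := fun x => by
      rw [Finsupp.prod_fintype _ _ (by simp), mul_assoc, Finset.prod_mul_distrib]
    simp_rw [h1]
    rw [← Finset.mul_sum,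
      ← Finset.prod_univ_sum A fun i u => u ^ d i * interpWeight (A i) u]
    split_ifs with hd0
    · subst hd0
      rw [Finset.prod_eq_one, mul_one]
      intro i _
      simpa using sum_zpow_mul_interpWeight (hA i) (h0 i) le_rfl (by norm_num)
    -- Negative exponents are not controlled, but a nonzero exponent vector of sum 0 has a positive
    -- entry, and that coordinate alone makes the product vanish.
    · obtain ⟨i, hi⟩ : ∃ i, 0 < d i := by
        by_contra! h
        apply hd0
        ext i
        exact (Finset.sum_eq_zero_iff_of_nonpos fun i _ => h i).1 hsum i (Finset.mem_univ i)
      rw [Finset.prod_eq_zero (Finset.mem_univ i), mul_zero]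
      rw [sum_zpow_mul_interpWeight (hA i) (h0 i) hi.le (hle i), if_neg hi.ne']
  simp only [eval, Finsupp.sum, Finset.sum_mul]
  rw [Finset.sum_comm, Finset.sum_congr rfl key, Finset.sum_ite_eq']
  split_ifs with h
  · rfl
  · rw [Finsupp.notMem_support_iff] at h
    rw [CT, h, Int.cast_zero]

theorem prod_one_sub_ratio {σ ι : Type*} [Fintype ι] [DecidableEq ι] (num den : ι → σ) :
    ∏ e, (1 - ratio (num e) (den e)) =
      ∑ s : ι → ZMod 2, AddMonoidAlgebra.single
        (∑ e, (s e).val • (Finsupp.single (num e) (1 : ℤ) - Finsupp.single (den e) 1))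
        (∏ e, (-1 : ℤ) ^ (s e).val) := by
  have h : ∀ e, 1 - ratio (num e) (den e) = ∑ a : ZMod 2, AddMonoidAlgebra.single
      (a.val • (Finsupp.single (num e) (1 : ℤ) - Finsupp.single (den e) 1))
      ((-1 : ℤ) ^ a.val) := fun e => by
    change _ = ∑ a : Fin 2, AddMonoidAlgebra.single
      (a.val • (Finsupp.single (num e) (1 : ℤ) - Finsupp.single (den e) 1)) ((-1 : ℤ) ^ a.val)
    rw [Fin.sum_univ_two]
    simp [ratio, sub_eq_add_neg, AddMonoidAlgebra.one_def]
  simp_rw [h, Fintype.prod_sum, AddMonoidAlgebra.prod_single]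

theorem eval_prod_one_sub_ratio {σ ι K : Type*} [Fintype ι] [Field K] (num den : ι → σ)
    {x : σ → K} (hx : ∀ i, x i ≠ 0) :
    (∏ e, (1 - ratio (num e) (den e))).eval x = ∏ e, (1 - x (num e) / x (den e)) := by
  let F : Multiplicative (σ →₀ ℤ) →* K :=
    { toFun := fun d => (Multiplicative.toAdd d).prod fun i m => x i ^ m
      map_one' := by simp
      map_mul' := fun a b => by
        classical
        rw [toAdd_mul, Finsupp.prod_add_index' (by simp) fun i a b => zpow_add₀ (hx i) a b] }
  have hFd : ∀ d, F (Multiplicative.ofAdd d) = d.prod fun i m => x i ^ m := fun _ => rfl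
  have hF : ∀ f : MvLaurent σ, f.eval x = AddMonoidAlgebra.lift ℤ K (σ →₀ ℤ) F f := fun f => by
    rw [AddMonoidAlgebra.lift_apply]
    simp only [eval, hFd, zsmul_eq_mul]
  rw [hF, map_prod]
  refine Finset.prod_congr rfl fun e _ => ?_
  rw [map_sub, map_one, ratio, AddMonoidAlgebra.lift_single]
  have : Finsupp.single (num e) (1 : ℤ) - Finsupp.single (den e) 1 =
    Finsupp.single (num e) (1 : ℤ) + Finsupp.single (den e) (-1) := by
      rw [Finsupp.single_neg, sub_eq_add_neg]
  rw [hFd, this, Finsupp.prod_add_index' (by simp) fun i a b => zpow_add₀ (hx i) a b]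
  rw [Finsupp.prod_single_index (by simp), Finsupp.prod_single_index (by simp)]
  simp [div_eq_mul_inv]

end MvLaurent

/-! ### A parity identity for products of row sums -/

/-- Expanding the product gives one term for each map `f : ι → ι`. Non-bijective maps and nontrivial
involutions contribute 0, other bijections cancel against their inverses, and the identity
contributes an odd power. -/
theorem ZMod.two_sum_prod_sum_eq_one {ι κ : Type*} [Fintype ι] [DecidableEq ι]
    [Fintype κ] [DecidableEq κ] (hκ : Odd (Fintype.card κ)) (c : ι → ι → κ → κ → ZMod 2)
    (hdiag : ∀ i p, c i i p p = 1) (hsymm : ∀ i j, i ≠ j → ∀ p q, c i j p q = c j i q p)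
    (hsum : ∀ i j q, i ≠ j → ∑ p, c i j p q = 0) :
    ∑ X : ι → κ, ∏ i, ∑ j, c i j (X i) (X j) = 1 := by
  classical
  have update_zero : ∀ (g : (ι → κ) → ZMod 2) (i : ι),
      (∀ X, ∑ p, g (Function.update X i p) = 0) → ∑ X, g X = 0 := by
    intro g i h
    have e := Fintype.sum_equiv (Equiv.funSplitAt i κ) g
      (fun y => g ((Equiv.funSplitAt i κ).symm y))
      fun X => by rw [Equiv.symm_apply_apply]
    rw [e, Fintype.sum_prod_type_right]
    refine Finset.sum_eq_zero fun y _ => ?_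
    obtain ⟨p0⟩ : Nonempty κ := by
      rw [← Fintype.card_pos_iff]; exact hκ.pos
    rw [← h ((Equiv.funSplitAt i κ).symm (p0, y))]
    refine Finset.sum_congr rfl fun p _ => congrArg g ?_
    ext j
    by_cases hj : j = i
    · subst hj; simp [Equiv.funSplitAt, Equiv.piSplitAt]
    · simp [Equiv.funSplitAt, Equiv.piSplitAt, hj]
  have sq : ∀ a : ZMod 2, a * a = a := by decide
  simp_rw [Fintype.prod_sum]
  rw [Finset.sum_comm]
  -- maps that are not surjective contribute nothing
  have hns : ∀ f : ι → ι, ¬ Function.Bijective f → ∑ X : ι → κ, ∏ i, c i (f i) (X i) (X (f i)) = 0 := by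
    intro f hf
    have hs : ¬ Function.Surjective f := fun h => hf (Finite.surjective_iff_bijective.1 h)
    obtain ⟨i, hi⟩ : ∃ i, ∀ j, f j ≠ i := by simpa [Function.Surjective] using hs
    -- As `i` is not in the image of `f`, the value `X i` enters a single factor.
    refine update_zero _ i fun X => ?_
    have : ∀ p, ∏ j, c j (f j) (Function.update X i p j) (Function.update X i p (f j)) =
        c i (f i) p (X (f i)) * ∏ j ∈ Finset.univ.erase i, c j (f j) (X j) (X (f j)) := fun p => by
      rw [← Finset.mul_prod_erase _ _ (Finset.mem_univ i), Function.update_self,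
        Function.update_of_ne (hi i)]
      congr 1
      refine Finset.prod_congr rfl fun j hj => ?_
      rw [Function.update_of_ne (Finset.ne_of_mem_erase hj), Function.update_of_ne (hi j)]
    simp_rw [this, ← Finset.sum_mul]
    rw [hsum i (f i) _ (hi i).symm, zero_mul]
  have hinvol : ∀ f : ι → ι, f.Involutive → f ≠ id →
      ∑ X : ι → κ, ∏ i, c i (f i) (X i) (X (f i)) = 0 := by
    intro f hf hne
    obtain ⟨i, hi⟩ : ∃ i, f i ≠ i := by simpa [funext_iff] using hne
    refine update_zero _ i fun X => ?_
    -- The factors at `i` and `f i` agree by symmetry, and their product is one copy since `a * a =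
    -- a`; again `X i` enters a single factor.
    have : ∀ p, ∏ j, c j (f j) (Function.update X i p j) (Function.update X i p (f j)) =
        c i (f i) p (X (f i)) *
          ∏ j ∈ (Finset.univ.erase i).erase (f i), c j (f j) (X j) (X (f j)) := fun p => by
      rw [← Finset.mul_prod_erase _ _ (Finset.mem_univ i), Function.update_self,
        Function.update_of_ne hi, ← Finset.mul_prod_erase _ _
          (Finset.mem_erase.2 ⟨hi, Finset.mem_univ (f i)⟩), hf i, Function.update_self,
        Function.update_of_ne hi, ← hsymm i (f i) hi.symm, ← mul_assoc, sq]
      congr 1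
      refine Finset.prod_congr rfl fun j hj => ?_
      simp only [Finset.mem_erase, Finset.mem_univ, and_true] at hj
      rw [Function.update_of_ne hj.2, Function.update_of_ne fun h => hj.1 (by rw [← h, hf j])]
    simp_rw [this, ← Finset.sum_mul]
    rw [hsum i (f i) _ hi.symm, zero_mul]
  have hid : ∑ X : ι → κ, ∏ i, c i (id i) (X i) (X (id i)) = 1 := by
    simp only [id, hdiag, Finset.prod_const_one, Finset.sum_const, Finset.card_univ,
      Fintype.card_fun, nsmul_eq_mul, mul_one]
    rw [ZMod.natCast_eq_one_iff_odd]
    exact hκ.pow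
  rw [← Finset.add_sum_erase _ _ (Finset.mem_univ (id : ι → ι)), hid, add_eq_left]
  have hsub := Finset.sum_subset (s₁ := (Finset.univ.filter fun f : ι → ι =>
    Function.Bijective f ∧ ¬ f.Involutive))
    (s₂ := Finset.univ.erase id) (f := fun f => ∑ X : ι → κ, ∏ i, c i (f i) (X i) (X (f i)))
    (fun f hf => by
      rw [Finset.mem_filter, and_iff_right (Finset.mem_univ f)] at hf
      refine Finset.mem_erase.2 ⟨?_, Finset.mem_univ _⟩
      rintro rfl
      exact hf.2 fun _ => rfl)
    (fun f hf hf' => by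
      rw [Finset.mem_filter, and_iff_right (Finset.mem_univ f), not_and, not_not] at hf'
      by_cases hb : Function.Bijective f
      · exact hinvol f (hf' hb) (Finset.ne_of_mem_erase hf)
      · exact hns f hb)
  rw [← hsub]
  have hinv : ∀ f : ι → ι, Function.Bijective f → ∃ g : ι → ι, g ∘ f = id ∧ f ∘ g = id :=
    fun f hf => by
      obtain ⟨g, h1, h2⟩ := Function.bijective_iff_has_inverse.1 hf
      exact ⟨g, funext h1, funext h2⟩
  choose! g hg1 hg2 using hinv
  have hgb : ∀ f : ι → ι, Function.Bijective f → Function.Bijective (g f) := fun f hf =>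
    Function.bijective_iff_has_inverse.2 ⟨f, congrFun (hg2 f hf), congrFun (hg1 f hf)⟩
  have hmem : ∀ f : ι → ι, f ∈ (Finset.univ.filter fun f : ι → ι =>
      Function.Bijective f ∧ ¬ f.Involutive) ↔ Function.Bijective f ∧ ¬ f.Involutive := fun f => by
    rw [Finset.mem_filter, and_iff_right (Finset.mem_univ f)]
  refine Finset.sum_involution (fun f _ => g f) ?_ ?_ ?_ ?_
  · intro f hf
    have hb := ((hmem f).1 hf).1
    rw [CharTwo.add_eq_zero]
    refine Finset.sum_congr rfl fun X _ => ?_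
    refine Fintype.prod_bijective f hb _ _ fun i => ?_
    have hgi : g f (f i) = i := congrFun (hg1 f hb) i
    rw [hgi]
    by_cases h : i = f i
    · rw [← h]
    · exact hsymm _ _ h _ _
  · intro f hf _ h
    obtain ⟨hb, hi⟩ := (hmem f).1 hf
    exact hi fun x => by
      have := congrFun (hg1 f hb) x
      rwa [h] at this
  · intro f hf
    obtain ⟨hb, hi⟩ := (hmem f).1 hf
    refine (hmem _).2 ⟨hgb f hb, fun h => hi fun x => ?_⟩
    have h1 : ∀ y, g f (f y) = y := congrFun (hg1 f hb)
    have := h (f (f x))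
    rw [h1, h1] at this
    exact this.symm
  · intro f hf
    obtain ⟨hb, hi⟩ := (hmem f).1 hf
    funext x
    have h1 : ∀ y, g (g f) (g f y) = y := congrFun (hg1 (g f) (hgb f hb))
    have := h1 (f x)
    rwa [show g f (f x) = x from congrFun (hg1 f hb) x] at this

/-! ### Parity of half the signed count -/

/-- The signed number of ways to select edges of a directed triangle so that the excess at the
vertex `j` equals `a j - b j`. -/
def triangleWeight (a b : Fin 3 → ZMod 2) : ℤ :=
  ∑ t : Fin 3 → ZMod 2,
    if ∀ j, ((t j).val : ℤ) - (t (j - 1)).val = (a j).val - (b j).val then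
      ∏ j, (-1 : ℤ) ^ (t j).val else 0

/-- Complementing `t` too turns each equation into an equivalent one and flips three signs. -/
theorem triangleWeight_add_one (a b : Fin 3 → ZMod 2) :
    triangleWeight (fun j => a j + 1) (fun j => b j + 1) = -triangleWeight a b := by
  rw [triangleWeight, triangleWeight, ← Finset.sum_neg_distrib]
  refine Fintype.sum_equiv (Equiv.addRight 1) _ _ fun t => ?_
  have h : ∀ a b c d : ZMod 2, ((a.val : ℤ) - b.val = ((c + 1).val : ℤ) - (d + 1).val ↔
    ((a + 1).val : ℤ) - (b + 1).val = (c.val : ℤ) - d.val) := by decide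
  have h' : ∀ a : ZMod 2, (-1 : ℤ) ^ (a + 1).val = -(-1 : ℤ) ^ a.val := by decide
  simp only [h, Equiv.coe_addRight, Pi.add_apply, Pi.one_apply, h', Finset.prod_neg]
  split_ifs <;> simp [pow_succ]

-- If `a = b`, only the empty and the full selection occur, with opposite signs. Otherwise the
-- excesses must be `1`, `-1` and `0`; then `t` is unique, and the two values of `a` off `p` sum to
-- 1.
set_option maxRecDepth 10000 in
theorem triangleWeight_cast (a b : Fin 3 → ZMod 2) :
    (triangleWeight a b : ZMod 2) =
      ∑ p, if ∀ l, a l = b l + (if l = p then 0 else 1) then ∑ l ∈ Finset.univ.erase p, a l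
        else 0 := by
  have : ∀ a b : Fin 3 → ZMod 2, (triangleWeight a b : ZMod 2) =
      ∑ p, if ∀ l, a l = b l + (if l = p then 0 else 1) then ∑ l ∈ Finset.univ.erase p, a l
        else 0 := by decide +kernel
  exact this a b

/-- The vanishing total lets the recursion close up around the cycle; the value at the last position
removes the freedom of adding a constant. -/
theorem eq_partialSum_iff_cyclic {m : ℕ} {g : Fin (m + 1) → ZMod 2} (hg : ∑ v, g v = 0)
    (s : Fin (m + 1) → ZMod 2) :
    (s (Fin.last m) = 0 ∧ ∀ v, s v = s ((finRotate (m + 1)).symm v) + g v) ↔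
      s = fun v => ∑ y ∈ Finset.Iic v, g y := by
  constructor
  · rintro ⟨h0, h⟩
    funext v
    induction v using Fin.induction with
    | zero =>
      have h1 : (finRotate (m + 1)).symm 0 = Fin.last m := by
        rw [Equiv.symm_apply_eq, finRotate_last]
      rw [h, h1, h0, zero_add, show Finset.Iic (0 : Fin (m + 1)) = {0} by
        ext y; simp, Finset.sum_singleton]
    | succ v ih =>
      have h1 : (finRotate (m + 1)).symm v.succ = v.castSucc := by
        rw [Equiv.symm_apply_eq, finRotate_apply, Fin.coeSucc_eq_succ]
      rw [h, h1, ih, show Finset.Iic v.succ = insert v.succ (Finset.Iic v.castSucc) by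
        ext y; simp [Fin.le_def, Fin.ext_iff]; omega, Finset.sum_insert (by simp), add_comm]
  · rintro rfl
    have hlast : ∑ y ∈ Finset.Iic (Fin.last m), g y = 0 := by
      rw [← hg]; congr 1; ext y; simp [Fin.le_last]
    refine ⟨hlast, fun v => ?_⟩
    beta_reduce
    induction v using Fin.cases with
    | zero =>
      have h1 : (finRotate (m + 1)).symm 0 = Fin.last m := by
        rw [Equiv.symm_apply_eq, finRotate_last]
      rw [h1, hlast, zero_add, show Finset.Iic (0 : Fin (m + 1)) = {0} by
        ext y; simp, Finset.sum_singleton]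
    | succ v =>
      have h1 : (finRotate (m + 1)).symm v.succ = v.castSucc := by
        rw [Equiv.symm_apply_eq, finRotate_apply, Fin.coeSucc_eq_succ]
      rw [h1, show Finset.Iic v.succ = insert v.succ (Finset.Iic v.castSucc) by
        ext y; simp [Fin.le_def, Fin.ext_iff]; omega, Finset.sum_insert (by simp), add_comm]

theorem sum_prod_triangleWeight_cast {ι : Type*} [Fintype ι] [DecidableEq ι] {m : ℕ}
    (τ : ι × Fin 3 ≃ Fin (m + 1)) :
    ∑ s : Fin (m + 1) → ZMod 2 with s (Fin.last m) = 0,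
      ∏ i, (triangleWeight (fun j => s (τ (i, j)))
        (fun j => s ((finRotate (m + 1)).symm (τ (i, j)))) : ZMod 2) = 1 := by
  -- Partial sums count the changes at earlier positions, so this is the contribution of the changes
  -- in triangle `j` to the values of `s` in triangle `i`. On the diagonal it counts 3 pairs; off
  -- it, `c i j p q` and `c j i q p` count 4 pairs together.
  let c : ι → ι → Fin 3 → Fin 3 → ZMod 2 := fun i j p q =>
    ∑ l ∈ Finset.univ.erase p, ∑ k ∈ Finset.univ.erase q, if τ (j, k) ≤ τ (i, l) then 1 else 0
  have herase : ∀ F : Fin 3 → ZMod 2, ∑ p, ∑ l ∈ Finset.univ.erase p, F l = 0 := fun F => by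
    have : ∀ p, ∑ l ∈ Finset.univ.erase p, F l = ∑ l, F l - F p := fun p => by
      rw [← Finset.add_sum_erase _ _ (Finset.mem_univ p), add_sub_cancel_left]
    simp_rw [this, Finset.sum_sub_distrib, Finset.sum_const, Finset.card_univ, Fintype.card_fin]
    rw [show 3 • ∑ l, F l = 2 • ∑ l, F l + ∑ l, F l from succ_nsmul _ 2, CharTwo.two_nsmul,
      zero_add, sub_self]
  have hcard : ∀ p : Fin 3, ∃ a b : Fin 3, a ≠ b ∧ Finset.univ.erase p = {a, b} := by decide
  have hc := ZMod.two_sum_prod_sum_eq_one (κ := Fin 3) (by decide) c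
    (fun i p => by
      obtain ⟨a, b, hab, he⟩ := hcard p
      have hne : τ (i, a) ≠ τ (i, b) := fun h => hab (congrArg Prod.snd (τ.injective h))
      simp only [c, he, Finset.sum_pair hab, le_refl, if_true]
      rcases hne.lt_or_gt with h | h
      · rw [if_neg h.not_ge, if_pos h.le]; decide
      · rw [if_neg h.not_ge, if_pos h.le]; decide)
    (fun i j hij p q => by
      have h : ∀ k l, (if τ (j, k) ≤ τ (i, l) then 1 else 0 : ZMod 2) =
          (if τ (i, l) ≤ τ (j, k) then 1 else 0) + 1 := fun k l => by
        have hne : τ (i, l) ≠ τ (j, k) := fun h => hij (congrArg Prod.fst (τ.injective h))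
        rcases hne.lt_or_gt with h | h
        · rw [if_neg h.not_ge, if_pos h.le]; decide
        · rw [if_neg h.not_ge, if_pos h.le]; decide
      simp only [c, h, Finset.sum_add_distrib]
      rw [Finset.sum_comm, add_eq_left]
      obtain ⟨a, b, hab, he⟩ := hcard p
      rw [he, Finset.sum_pair hab, CharTwo.add_self_eq_zero])
    (fun i j q _ => herase _)
  simp_rw [triangleWeight_cast, Fintype.prod_sum, Finset.prod_ite_zero]
  rw [Finset.sum_comm]
  refine Eq.trans ?_ hc
  refine Finset.sum_congr rfl fun X _ => ?_
  -- The prescribed change at each vertex: none at the vertex chosen by `X`, one at the other two of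
  -- the triangle.
  let g : Fin (m + 1) → ZMod 2 := fun v => if (τ.symm v).2 = X (τ.symm v).1 then 0 else 1
  have hgτ : ∀ i l, g (τ (i, l)) = if l = X i then 0 else 1 := fun i l => by simp [g]
  have hgsum : ∀ F : Fin (m + 1) → ZMod 2,
      ∑ v, g v * F v = ∑ i, ∑ l ∈ Finset.univ.erase (X i), F (τ (i, l)) := fun F => by
    rw [← Equiv.sum_comp τ, Fintype.sum_prod_type]
    refine Finset.sum_congr rfl fun i _ => ?_
    rw [← Finset.add_sum_erase _ _ (Finset.mem_univ (X i))]
    simp only [hgτ, if_true, zero_mul, zero_add]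
    refine Finset.sum_congr rfl fun l hl => ?_
    rw [if_neg (Finset.ne_of_mem_erase hl), one_mul]
  have hg0 : ∑ v, g v = 0 := by
    have := hgsum 1
    simp only [Pi.one_apply, mul_one] at this
    rw [this]
    refine Finset.sum_eq_zero fun i _ => ?_
    obtain ⟨a, b, hab, he⟩ := hcard (X i)
    rw [he, Finset.sum_pair hab]; decide
  have hiff : ∀ s : Fin (m + 1) → ZMod 2, (s (Fin.last m) = 0 ∧ ∀ i ∈ Finset.univ, ∀ l,
      s (τ (i, l)) = s ((finRotate (m + 1)).symm (τ (i, l))) + if l = X i then 0 else 1) ↔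
      s = fun v => ∑ y ∈ Finset.Iic v, g y := fun s => by
    rw [← eq_partialSum_iff_cyclic hg0 s]
    refine and_congr_right fun _ => ⟨fun h v => ?_, fun h i _ l => ?_⟩
    · obtain ⟨⟨i, l⟩, rfl⟩ := τ.surjective v
      rw [h i (Finset.mem_univ i) l, hgτ]
    · rw [h, hgτ]
  rw [Finset.sum_filter]
  simp_rw [← ite_and, hiff, Finset.sum_ite_eq', Finset.mem_univ, if_true]
  refine Finset.prod_congr rfl fun i _ => ?_
  simp only [c]
  rw [Finset.sum_comm]
  refine Finset.sum_congr rfl fun l _ => ?_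
  have := hgsum fun y => if y ≤ τ (i, l) then 1 else 0
  rw [← this]
  simp only [mul_ite, mul_one, mul_zero]
  rw [← Finset.sum_filter]
  exact Finset.sum_congr (by ext y; simp) fun _ _ => rfl

theorem sum_sign_mul_prod_triangleWeight_ne_zero {ι : Type*} [Fintype ι] [DecidableEq ι] {N : ℕ}
    [NeZero N] (τ : ι × Fin 3 ≃ Fin N) :
    ∑ s : Fin N → ZMod 2, (∏ v, (-1 : ℤ) ^ (s v).val) *
      ∏ i, triangleWeight (fun j => s (τ (i, j))) (fun j => s ((finRotate N).symm (τ (i, j)))) ≠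
        0 := by
  obtain ⟨m, rfl⟩ := Nat.exists_eq_succ_of_ne_zero (NeZero.ne N)
  set f : (Fin (m + 1) → ZMod 2) → ℤ := fun s => (∏ v, (-1 : ℤ) ^ (s v).val) *
      ∏ i, triangleWeight (fun j => s (τ (i, j)))
        (fun j => s ((finRotate (m + 1)).symm (τ (i, j)))) with hf
  have hodd : ((∑ s with s (Fin.last m) = 0, f s : ℤ) : ZMod 2) = 1 := by
    rw [← sum_prod_triangleWeight_cast τ, Int.cast_sum]
    refine Finset.sum_congr rfl fun s _ => ?_
    simp [hf, show (-1 : ZMod 2) = 1 from rfl]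
  have hcard : m + 1 = Fintype.card ι * 3 := by
    simpa using (Fintype.card_congr τ).symm
  have hneg : ∀ s, f (s + 1) = f s := fun s => by
    have h' : ∀ a : ZMod 2, (-1 : ℤ) ^ (a + 1).val = -(-1 : ℤ) ^ a.val := by decide
    simp only [hf, Pi.add_apply, Pi.one_apply, h', triangleWeight_add_one, Finset.prod_neg,
      Finset.card_univ, Fintype.card_fin]
    -- One sign for each of the `3n` cycle edges and one for each of the `n` triangles.
    have : (-1 : ℤ) ^ (m + 1) * (-1) ^ Fintype.card ι = 1 := by
      rw [hcard, pow_mul', ← mul_pow]; norm_num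
    linear_combination (∏ v, (-1 : ℤ) ^ (s v).val) * (∏ i, triangleWeight (fun j => s (τ (i, j)))
      (fun j => s ((finRotate (m + 1)).symm (τ (i, j))))) * this
  have hhalf : ∑ s with ¬ s (Fin.last m) = 0, f s = ∑ s with s (Fin.last m) = 0, f s := by
    have h2 : ∀ a : ZMod 2, ¬ a = 0 ↔ a + 1 = 0 := by decide
    refine Finset.sum_equiv (Equiv.addRight 1) (fun s => ?_) fun s _ => (hneg s).symm
    simp [h2]
  change ∑ s, f s ≠ 0
  rw [← Finset.sum_filter_add_sum_filter_not _ (fun s => s (Fin.last m) = 0), hhalf]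
  intro h
  have : ∑ s with s (Fin.last m) = 0, f s = 0 := by linarith
  rw [this] at hodd
  exact absurd hodd (by decide)

/-! ### The constant term of `Phi` and list colouring -/

namespace CyclePlusTriangles

variable {V : Type uV} {E : Type uE} {G : Graph V E} {n : ℕ}

/-- The vertices of the triangles as positions on the cycle. -/
def triIndex (D : CyclePlusTriangles G n) : Fin n × Fin 3 ≃ Fin (3 * n) :=
  D.tri.trans D.x.symm

/-- The variable in the numerator of the factor of `Phi` that belongs to an edge. -/
def numIndex (D : CyclePlusTriangles G n) : Fin (3 * n) ⊕ Fin n × Fin 3 → Fin (3 * n) :=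
  Sum.elim (finRotate (3 * n)) D.triIndex

/-- The variable in the denominator of the factor of `Phi` that belongs to an edge. -/
def denIndex (D : CyclePlusTriangles G n) : Fin (3 * n) ⊕ Fin n × Fin 3 → Fin (3 * n) :=
  Sum.elim id fun p => D.triIndex (p.1, p.2 + 1)

theorem Phi_eq_prod (D : CyclePlusTriangles G n) :
    D.Phi = ∏ e, (1 - MvLaurent.ratio (D.numIndex e) (D.denIndex e)) := by
  rw [Fintype.prod_sum_type, Fintype.prod_prod_type]
  rfl

/-- The exponent of the monomial of the expansion of `Phi` that is given by a set of edges. -/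
noncomputable def exponent (D : CyclePlusTriangles G n)
    (s : Fin (3 * n) ⊕ Fin n × Fin 3 → ZMod 2) : Fin (3 * n) →₀ ℤ :=
  ∑ e, (s e).val • (Finsupp.single (D.numIndex e) 1 - Finsupp.single (D.denIndex e) 1)

theorem Phi_eq_sum (D : CyclePlusTriangles G n) :
    D.Phi = ∑ s, AddMonoidAlgebra.single (D.exponent s) (∏ e, (-1 : ℤ) ^ (s e).val) := by
  rw [Phi_eq_prod, MvLaurent.prod_one_sub_ratio]
  rfl

theorem exponent_apply (D : CyclePlusTriangles G n)
    (s : Fin (3 * n) ⊕ Fin n × Fin 3 → ZMod 2) (i : Fin n) (j : Fin 3) :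
    D.exponent s (D.triIndex (i, j)) =
    ((s (.inl ((finRotate (3 * n)).symm (D.triIndex (i, j))))).val -
      (s (.inl (D.triIndex (i, j)))).val) +
      (((s (.inr (i, j))).val : ℤ) - (s (.inr (i, j - 1))).val) := by
  have h1 : ∀ a : Fin (3 * n), finRotate (3 * n) a = D.triIndex (i, j) ↔
      a = (finRotate (3 * n)).symm (D.triIndex (i, j)) := fun a => by
    rw [Equiv.eq_symm_apply]
  have h2 : ∀ a : Fin n × Fin 3, D.triIndex (a.1, a.2 + 1) = D.triIndex (i, j) ↔
      a = (i, j - 1) := fun a => by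
    rw [D.triIndex.injective.eq_iff, Prod.ext_iff, Prod.ext_iff, eq_sub_iff_add_eq]
  rw [exponent, Finsupp.finsetSum_apply]
  simp only [Fintype.sum_sum_type, numIndex, denIndex, Sum.elim_inl, Sum.elim_inr, id]
  simp only [Finsupp.smul_apply, Finsupp.sub_apply, Finsupp.single_apply, h1, h2,
    D.triIndex.injective.eq_iff, smul_sub, Finset.sum_sub_distrib, smul_ite, smul_zero,
    Finset.sum_ite_eq', Finset.mem_univ, if_true, nsmul_eq_mul, mul_one]

theorem sum_exponent (D : CyclePlusTriangles G n)
    (s : Fin (3 * n) ⊕ Fin n × Fin 3 → ZMod 2) :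
    ∑ v, D.exponent s v = 0 := by
  simp only [exponent, Finsupp.finsetSum_apply]
  rw [Finset.sum_comm]
  refine Finset.sum_eq_zero fun e _ => ?_
  simp [Finsupp.single_apply, ← Finset.mul_sum]

/-- Each variable is the numerator of just two factors, one from the cycle and one from its
triangle. -/
theorem exponent_le_two (D : CyclePlusTriangles G n)
    (s : Fin (3 * n) ⊕ Fin n × Fin 3 → ZMod 2) (v : Fin (3 * n)) :
    D.exponent s v ≤ 2 := by
  obtain ⟨⟨i, j⟩, rfl⟩ := D.triIndex.surjective v
  rw [exponent_apply]
  have h : ∀ a : ZMod 2, a.val < 2 := fun a => ZMod.val_lt a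
  have h1 := h (s (.inl ((finRotate (3 * n)).symm (D.triIndex (i, j)))))
  have h2 := h (s (.inr (i, j)))
  omega

theorem mem_support_Phi (D : CyclePlusTriangles G n) {d : Fin (3 * n) →₀ ℤ}
    (hd : d ∈ D.Phi.coeff.support) : ∑ i, d i = 0 ∧ ∀ i, d i ≤ 2 := by
  classical
  rw [Phi_eq_sum, AddMonoidAlgebra.coeff_sum,
    Finsupp.mem_support_iff, Finsupp.finsetSum_apply] at hd
  obtain ⟨s, -, hs⟩ := Finset.exists_ne_zero_of_sum_ne_zero hd
  rw [AddMonoidAlgebra.coeff_single, Finsupp.single_apply, ite_ne_right_iff] at hs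
  rw [← hs.1]
  exact ⟨D.sum_exponent s, D.exponent_le_two s⟩

/-- Once the cycle part `s` is fixed, the balance conditions split into separate conditions on the
triangles. -/
theorem CT_Phi (D : CyclePlusTriangles G n) :
    D.Phi.CT = ∑ s : Fin (3 * n) → ZMod 2, (∏ v, (-1 : ℤ) ^ (s v).val) *
      ∏ i, triangleWeight (fun j => s (D.triIndex (i, j)))
        (fun j => s ((finRotate (3 * n)).symm (D.triIndex (i, j)))) := by
  classical
  have hcond : ∀ s : Fin (3 * n) ⊕ Fin n × Fin 3 → ZMod 2, D.exponent s = 0 ↔ ∀ i ∈ Finset.univ, ∀ j,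
      ((s (.inr (i, j))).val : ℤ) - (s (.inr (i, j - 1))).val =
        (s (.inl (D.triIndex (i, j)))).val -
          (s (.inl ((finRotate (3 * n)).symm (D.triIndex (i, j))))).val := fun s => by
    rw [Finsupp.ext_iff, ← D.triIndex.forall_congr_right, Prod.forall]
    simp only [exponent_apply, Finsupp.zero_apply, Finset.mem_univ, true_imp_iff]
    refine forall₂_congr fun i j => ?_
    constructor <;> intro h <;> linarith
  rw [Phi_eq_sum, MvLaurent.CT, AddMonoidAlgebra.coeff_sum,
    Finsupp.finsetSum_apply]
  simp only [AddMonoidAlgebra.coeff_single, Finsupp.single_apply, hcond]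
  rw [← (Equiv.sumArrowEquivProdArrow (Fin (3 * n)) (Fin n × Fin 3) (ZMod 2)).symm.sum_comp,
    Fintype.sum_prod_type]
  refine Finset.sum_congr rfl fun s _ => ?_
  simp only [triangleWeight]
  rw [Fintype.prod_sum, Finset.mul_sum,
    ← (Equiv.curry (Fin n) (Fin 3) (ZMod 2)).symm.sum_comp]
  refine Finset.sum_congr rfl fun t _ => ?_
  rw [Finset.prod_ite_zero, mul_ite, mul_zero, Fintype.prod_sum_type, Fintype.prod_prod_type]
  split_ifs with h h' h'
  · rfl
  · exact absurd h h'
  · exact absurd h' h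
  · rfl

theorem CT_Phi_ne_zero (D : CyclePlusTriangles G n) (hn : 1 ≤ n) : D.Phi.CT ≠ 0 := by
  have : NeZero (3 * n) := ⟨by omega⟩
  rw [CT_Phi]
  exact sum_sign_mul_prod_triangleWeight_ne_zero D.triIndex

theorem CT_Phi_eq_sum (D : CyclePlusTriangles G n) {K : Type*} [Field K]
    (A : Fin (3 * n) → Finset K) (hA : ∀ i, (A i).card = 3) (h0 : ∀ i, (0 : K) ∉ A i) :
    ((D.Phi.CT : ℤ) : K) =
      ∑ x ∈ Fintype.piFinset A, D.Phi.eval x * ∏ i, interpWeight (A i) (x i) :=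
  MvLaurent.CT_eq_sum_eval_mul_interpWeight _ (fun _ => D.mem_support_Phi) A hA h0

theorem eval_Phi_ne_zero_iff (D : CyclePlusTriangles G n) {K : Type*} [Field K]
    {x : Fin (3 * n) → K} (hx : ∀ i, x i ≠ 0) :
    D.Phi.eval x ≠ 0 ↔ ∀ e, x (D.numIndex e) ≠ x (D.denIndex e) := by
  rw [Phi_eq_prod, MvLaurent.eval_prod_one_sub_ratio _ _ hx, Finset.prod_ne_zero_iff]
  refine ⟨fun h e he => h e (Finset.mem_univ e) ?_, fun h e _ he => h e ?_⟩
  · rw [he, div_self (hx _), sub_self]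
  · rw [sub_eq_zero, eq_div_iff (hx _), one_mul] at he
    exact he.symm

theorem isLink_edge (D : CyclePlusTriangles G n) (e : Fin (3 * n) ⊕ Fin n × Fin 3) :
    G.IsLink (D.edge e) (D.x (D.numIndex e)) (D.x (D.denIndex e)) := by
  rcases e with i | ⟨i, j⟩
  · exact (D.isLink_cycle i).symm
  · simpa [numIndex, denIndex, triIndex] using D.isLink_tri i j

theorem isChoosable (D : CyclePlusTriangles G n) (hn : 1 ≤ n) :
    Graph.IsChoosable.{uV, uE, uC} G 3 := by
  classical
  intro C L hL
  choose M hML hM using fun i => Finset.exists_subset_card_eq (hL (D.x i))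
  let U : Finset C := Finset.univ.biUnion M
  have hMU : ∀ i, ∀ c ∈ M i, c ∈ U := fun i c hc =>
    Finset.mem_biUnion.2 ⟨i, Finset.mem_univ i, hc⟩
  -- Colours become distinct positive rationals; in characteristic 0 the constant term stays
  -- nonzero.
  let φ : C → ℚ := fun c => if h : c ∈ U then ((U.equivFin ⟨c, h⟩ : ℕ) : ℚ) + 1 else 0
  have hφ : Set.InjOn φ U := fun a ha b hb hab => by
    rw [Finset.mem_coe] at ha hb
    simp only [φ, dif_pos ha, dif_pos hb, add_left_inj, Nat.cast_inj, Fin.val_inj,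
      EmbeddingLike.apply_eq_iff_eq, Subtype.mk.injEq] at hab
    exact hab
  have hφ0 : ∀ c ∈ U, φ c ≠ 0 := fun c hc => by
    simp only [φ, dif_pos hc]; positivity
  have hA0 : ∀ i, (0 : ℚ) ∉ (M i).image φ := fun i h => by
    obtain ⟨c, hc, h⟩ := Finset.mem_image.1 h
    exact hφ0 c (hMU i c hc) h
  have hCT := D.CT_Phi_eq_sum (fun i => (M i).image φ) (fun i => by
    rw [Finset.card_image_of_injOn (hφ.mono fun c hc => hMU i c hc), hM]) hA0
  have hne : ((D.Phi.CT : ℤ) : ℚ) ≠ 0 := Int.cast_ne_zero.2 (D.CT_Phi_ne_zero hn)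
  rw [hCT] at hne
  obtain ⟨x, hx, hx'⟩ := Finset.exists_ne_zero_of_sum_ne_zero hne
  rw [Fintype.mem_piFinset] at hx
  have hx0 : ∀ i, x i ≠ 0 := fun i h => hA0 i (h ▸ hx i)
  choose y hyM hy using fun i => Finset.mem_image.1 (hx i)
  have hproper := (D.eval_Phi_ne_zero_iff hx0).1 (left_ne_zero_of_mul hx')
  have hye : ∀ e, y (D.numIndex e) ≠ y (D.denIndex e) := fun e h =>
    hproper e (by rw [← hy, ← hy, h])
  refine ⟨fun v => y (D.x.symm v), fun v => ?_, fun e u v h => ?_⟩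
  · simpa using hML _ (hyM (D.x.symm v))
  · obtain ⟨e', he'⟩ := D.edge.surjective ⟨e, h.edge_mem⟩
    have hl := D.isLink_edge e'
    rw [he'] at hl
    rcases h.eq_and_eq_or_eq_and_eq hl with ⟨h1, h2⟩ | ⟨h1, h2⟩
    · simpa [Subtype.ext h1, Subtype.ext h2] using hye e'
    · simpa [Subtype.ext h1, Subtype.ext h2] using (hye e').symm

end CyclePlusTriangles

theorem mainTheorem5 {V : Type uV} {E : Type uE} (G : Graph V E) (n : ℕ) (hn : 1 ≤ n)
    (D : CyclePlusTriangles G n) :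
    (∀ (K : Type uK) [Field K] (A : Fin (3 * n) → Finset K),
      (∀ i, (A i).card = 3) → (∀ i, (0 : K) ∉ A i) →
        ((D.Phi.CT : ℤ) : K) =
          ∑ x ∈ Fintype.piFinset A, D.Phi.eval x * ∏ i, interpWeight (A i) (x i)) ∧
    D.Phi.CT ≠ 0 ∧
    (∀ (K : Type uK) [Field K] (A : Fin (3 * n) → Finset K),
      (∀ i, (A i).card = 3) → (∀ i, (0 : K) ∉ A i) →
        ∃ x ∈ Fintype.piFinset A, D.Phi.eval x ≠ 0) ∧
    Graph.IsChoosable.{uV, uE, uC} G 3 := by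
  refine ⟨fun K _ A hA h0 => D.CT_Phi_eq_sum A hA h0, D.CT_Phi_ne_zero hn,
    fun K _ A hA h0 => ?_, D.isChoosable hn⟩
  -- the constant term may vanish in `K`, so the point comes from a list colouring
  obtain ⟨c, hc, hproper⟩ := D.isChoosable hn K (fun v => A (D.x.symm v)) fun v => (hA _).ge
  have hcA : ∀ i, c (D.x i) ∈ A i := fun i => by simpa using hc (D.x i)
  refine ⟨fun i => c (D.x i), Fintype.mem_piFinset.2 hcA, ?_⟩
  exact (D.eval_Phi_ne_zero_iff fun i h => h0 i (h ▸ hcA i)).2 fun e =>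
    hproper _ _ _ (D.isLink_edge e)
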